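/- Let $m \in \{1, 2, 5, 7, 8, 10, 11, 13, 14, 16, 17, 19, 22, 23\}$, let $n \ge 0$ be an integer, and fix a choice of the sign $\mp \in \{-,+\}$, used consistently below ($\pm$ denotes the opposite sign). Put $i = 1$ if $m$ is odd, $i = 4$ if $m \in \{8, 16\}$, and $i = 2$ for the other even $m$, and define the integer $\delta_m(n)$ by $$2(m + 24n)\bigl(62208n^{2} + (5184m \mp 432)n + (108m^{2} \mp 18m + 1)\bigr) = 2^{i}\delta_{m}(n).$$ Assume that $\delta_m(n)$ is squarefree. Let $A = 18(m+24n) \mp 1$, $B = \pm 4/9$, $D = -3$, $r = 1/3 + A^2$, $$H = \frac{2ABD + 2A^{2}Dr + 3r^{2}}{16}, \qquad J = \frac{B^{2}D + 2ABDr + A^{2}Dr^{2} + r^{3}}{64},$$ and let $E_{m,n}/\mathbb{Q}$ be the elliptic curve $y^2 + xy = x^3 + Hx + J$. For every positive squarefree integer $d \equiv 1 \pmod{12}$, the quadratic twist $$E_{m,n}^{(d)} \colon\ y^2 + xy = x^3 + \frac{d-1}{4}x^2 + H d^2 x + J d^3$$ of $E_{m,n}$ by $d$ has trivial rational torsion subgroup: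 $E_{m,n}^{(d)}(\mathbb{Q})_{\mathrm{tors}} = 0$. -/

import Mathlib

namespace TwistTorsion

/-- The quadratic twist `W^{(d)}` of a Weierstrass curve over a field of characteristic `≠ 2`.
It is the curve with `b₂' = d b₂`, `b₄' = d² b₄`, `b₆' = d³ b₆` and the same `a₁`, `a₃`; i.e. it is
the model with coefficients `a₁, a₃` of the curve `d Y² = 4 X³ + b₂ X² + 2 b₄ X + b₆`. -/
def quadraticTwist {K : Type*} [Field K] (W : WeierstrassCurve K) (d : K) : WeierstrassCurve K where
  a₁ := W.a₁
  a₂ := d * W.a₂ + W.a₁ ^ 2 * (d - 1) / 4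
  a₃ := W.a₃
  a₄ := d ^ 2 * W.a₄ + W.a₁ * W.a₃ * (d ^ 2 - 1) / 2
  a₆ := d ^ 3 * W.a₆ + W.a₃ ^ 2 * (d ^ 3 - 1) / 4

/-- For `y² = x³ + a x + b` a pair `(x, y)` lies on `d y² = x³ + a x + b` if and only if
`(d x, d² y)` lies on the twist. -/
theorem quadraticTwist_short {K : Type*} [Field K] (a b d : K) (hd : d ≠ 0) (x y : K) :
    (quadraticTwist (⟨0, 0, 0, a, b⟩ : WeierstrassCurve K) d).toAffine.Equation
      (d * x) (d ^ 2 * y) ↔ d * y ^ 2 = x ^ 3 + a * x + b := by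
  rw [WeierstrassCurve.Affine.equation_iff]
  simp only [quadraticTwist]
  have h3 : d ^ 3 ≠ 0 := pow_ne_zero 3 hd
  constructor
  · intro h
    apply mul_left_cancel₀ h3
    linear_combination h
  · intro h
    linear_combination d ^ 3 * h

/-- `W^{(d)}` becomes isomorphic to `W` over every extension containing a square root of `d`. -/
theorem quadraticTwist_iso {K L : Type*} [Field K] [Field L] (φ : K →+* L) (h2 : (2 : L) ≠ 0)
    (W : WeierstrassCurve K) (d : K) (hd : d ≠ 0) (σ : L) (hσ : σ ^ 2 = φ d) :
    ∃ C : WeierstrassCurve.VariableChange L, C • W.map φ = (quadraticTwist W d).map φ := by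
  have hσ0 : σ ≠ 0 := by
    rintro rfl
    exact hd ((map_eq_zero φ).mp (by rw [← hσ]; simp))
  have h4 : (4 : L) ≠ 0 := by
    have : (4 : L) = 2 * 2 := by norm_num
    rw [this]; exact mul_ne_zero h2 h2
  have hφ2 : φ 2 = 2 := map_ofNat φ 2
  have hφ4 : φ 4 = 4 := map_ofNat φ 4
  refine ⟨⟨(Units.mk0 σ hσ0)⁻¹, 0, (σ⁻¹ - 1) * φ W.a₁ / 2, (σ⁻¹ ^ 3 - 1) * φ W.a₃ / 2⟩, ?_⟩
  ext <;> simp [WeierstrassCurve.variableChange_def, quadraticTwist, ← hσ, hφ2, hφ4] <;> field_simp <;> ring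

/-! In what follows `s = ∓1` is the sign written `∓`, so that `±` is `-s`. -/

/-- `A = 18 (m + 24 n) ∓ 1`. -/
def A (s m n : ℤ) : ℚ := 18 * (m + 24 * n) + s

/-- `B = ± 4/9`. -/
def B (s : ℤ) : ℚ := -s * (4 / 9)

/-- `D = -3`. -/
def D : ℚ := -3

/-- `r = 1/3 + A²`. -/
def r (s m n : ℤ) : ℚ := 1 / 3 + A s m n ^ 2

/-- `H(m, n) = (2ABD + 2A²Dr + 3r²) / 16`. -/
def H (s m n : ℤ) : ℚ :=
  (2 * A s m n * B s * D + 2 * A s m n ^ 2 * D * r s m n + 3 * r s m n ^ 2) / 16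

/-- `J(m, n) = (B²D + 2ABDr + A²Dr² + r³) / 64`. -/
def J (s m n : ℤ) : ℚ :=
  (B s ^ 2 * D + 2 * A s m n * B s * D * r s m n + A s m n ^ 2 * D * r s m n ^ 2
    + r s m n ^ 3) / 64

/-- The curve `E_{m,n} : y² + x y = x³ + H(m, n) x + J(m, n)` over `ℚ`. -/
def E (s m n : ℤ) : WeierstrassCurve ℚ where
  a₁ := 1
  a₂ := 0
  a₃ := 0
  a₄ := H s m n
  a₆ := J s m n

/-- `2 (m + 24n) (62208 n² + (5184 m ∓ 432) n + (108 m² ∓ 18 m + 1))`. -/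
def poly (s m n : ℤ) : ℤ :=
  2 * (m + 24 * n) *
    (62208 * n ^ 2 + (5184 * m + s * 432) * n + (108 * m ^ 2 + s * 18 * m + 1))

/-- The exponent `i`: `1` for odd `m`, `4` for `m = 8, 16`, and `2` for the other even `m`. -/
def expo (m : ℤ) : ℕ := if Odd m then 1 else if m = 8 ∨ m = 16 then 4 else 2

/-- `n` is admissible for `m` and the chosen sign when `δ_m(n)`, defined by
`2 (m + 24n) (62208 n² + ⋯) = 2 ^ i δ_m(n)`, is a squarefree integer. -/
def Admissible (s m n : ℤ) : Prop :=
  ∃ δ : ℤ, poly s m n = 2 ^ expo m * δ ∧ Squarefree δ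

/-- The discriminant of `E_{m,n}` is `∓ 2 (m + 24n) (62208 n² + ⋯)`. -/
theorem E_Δ (s m n : ℤ) (hs : s = 1 ∨ s = -1) : (E s m n).Δ = s * poly s m n := by
  rcases hs with rfl | rfl <;>
  · simp only [WeierstrassCurve.Δ, WeierstrassCurve.b₂, WeierstrassCurve.b₄, WeierstrassCurve.b₆,
      WeierstrassCurve.b₈, E, H, J, r, A, B, D, poly]
    push_cast
    ring

/-- The twists of `E_{m,n}` are elliptic curves when `n` is admissible. -/
theorem isElliptic_twist (s m n : ℤ) (hs : s = 1 ∨ s = -1) (hn : Admissible s m n)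
    (d : ℚ) (hd : d ≠ 0) : (quadraticTwist (E s m n) d).IsElliptic := by
  have hΔ : (quadraticTwist (E s m n) d).Δ = d ^ 6 * (E s m n).Δ := by
    simp only [WeierstrassCurve.Δ, WeierstrassCurve.b₂, WeierstrassCurve.b₄, WeierstrassCurve.b₆,
      WeierstrassCurve.b₈, quadraticTwist]
    ring
  obtain ⟨δ, h1, h2⟩ := hn
  have hp : poly s m n ≠ 0 := by
    rw [h1]; exact mul_ne_zero (by positivity) h2.ne_zero
  have hs0 : s ≠ 0 := by rcases hs with rfl | rfl <;> norm_num
  refine ⟨?_⟩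
  rw [hΔ, E_Δ s m n hs]
  exact (mul_ne_zero (pow_ne_zero 6 hd)
    (mul_ne_zero (by exact_mod_cast hs0) (by exact_mod_cast hp))).isUnit

end TwistTorsion

/-!
Completing the square in `E^{(d)}` and reducing modulo `3` gives `w² = x³ + x² + b₆` with `b₆ ≠ 0`,
whose points are killed by `6`. On the kernel of reduction tripling multiplies the `3`-adic absolute
value of the `x`-coordinate by exactly `9`, so that kernel is torsion-free and every rational
torsion point `P` satisfies `6 P = 0`.

It remains to exclude points of order `2` and `3`. Write `z = 4 x / d + r` and `a = A`, an integer
with `|a| > 1`. At a point of order `2`, `z³ = 3 (a z + B)²`; then `k = 4 s / (3 z)` is an integer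
with `k (3 a - k)² = 4 s`, which is impossible. At a point of order `3`, either `z = 0`, which makes
`-3 d` a square, or `(a + 3 B / z)³ + s³ = a³`, which contradicts Fermat's Last Theorem for
exponent `3`.
-/

namespace TwistTorsion

open Polynomial WeierstrassCurve

section DivisionPolynomials

variable {F : Type*} [Field F] {W : WeierstrassCurve F} {x y : F}

theorem eval_Ψ₂Sq_eq_sq (h : W.toAffine.Equation x y) :
    W.Ψ₂Sq.eval x = (y - W.toAffine.negY x y) ^ 2 := by
  rw [Affine.equation_iff] at h
  simp only [Ψ₂Sq, b₂, b₄, b₆, Affine.negY, eval_add, eval_mul, eval_pow, eval_X, eval_C]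
  linear_combination -4 * h

theorem eval_Ψ₂Sq_eq_zero_iff (h : W.toAffine.Equation x y) :
    W.Ψ₂Sq.eval x = 0 ↔ y = W.toAffine.negY x y := by
  rw [eval_Ψ₂Sq_eq_sq h, sq_eq_zero_iff, sub_eq_zero]

theorem eval_Ψ₃_eq (h : W.toAffine.Equation x y) :
    W.Ψ₃.eval x = (3 * x + W.a₂) * (y - W.toAffine.negY x y) ^ 2 -
      W.a₁ * (3 * x ^ 2 + 2 * W.a₂ * x + W.a₄ - W.a₁ * y) * (y - W.toAffine.negY x y) -
      (3 * x ^ 2 + 2 * W.a₂ * x + W.a₄ - W.a₁ * y) ^ 2 := by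
  rw [Affine.equation_iff] at h
  simp only [Ψ₃, b₂, b₄, b₆, b₈, Affine.negY, eval_add, eval_mul, eval_pow, eval_X, eval_C,
    eval_ofNat]
  linear_combination -(12 * x + W.a₁ ^ 2 + 4 * W.a₂) * h

theorem eval_Φ_two : (W.Φ 2).eval x = x * W.Ψ₂Sq.eval x - W.Ψ₃.eval x := by
  simp only [Φ_two, Ψ₂Sq, Ψ₃, eval_add, eval_sub, eval_mul, eval_pow, eval_X, eval_C, eval_ofNat]
  ring

theorem eval_preΨ₄ : W.preΨ₄.eval x =
    (6 * x ^ 2 + W.b₂ * x + W.b₄) * W.Ψ₃.eval x - W.Ψ₂Sq.eval x ^ 2 := by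
  simp only [preΨ₄, Ψ₂Sq, Ψ₃, eval_add, eval_mul, eval_pow, eval_X, eval_C, eval_ofNat]
  linear_combination x ^ 2 * W.b_relation

theorem eval_Ψ₃_ne_zero_of_eval_Ψ₂Sq_eq_zero (h : W.toAffine.Nonsingular x y)
    (hx : W.Ψ₂Sq.eval x = 0) : W.Ψ₃.eval x ≠ 0 := by
  have hy := (eval_Ψ₂Sq_eq_zero_iff h.1).mp hx
  have hn := ((Affine.nonsingular_iff ..).mp h).2.resolve_right (not_not_intro hy)
  rw [eval_Ψ₃_eq h.1, sub_eq_zero.mpr hy]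
  simpa [sub_eq_zero] using hn.symm

variable [DecidableEq F]

theorem two_nsmul_some_eq_zero_iff (h : W.toAffine.Nonsingular x y) :
    2 • Affine.Point.some x y h = 0 ↔ W.Ψ₂Sq.eval x = 0 := by
  rw [eval_Ψ₂Sq_eq_zero_iff h.1, two_nsmul]
  refine ⟨fun h0 ↦ ?_, Affine.Point.add_self_of_Y_eq⟩
  by_contra hy
  rw [Affine.Point.add_self_of_Y_ne hy] at h0
  exact Affine.Point.some_ne_zero _ h0

theorem slope_self_mul (h : y ≠ W.toAffine.negY x y) :
    W.toAffine.slope x x y y * (y - W.toAffine.negY x y) =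
      3 * x ^ 2 + 2 * W.a₂ * x + W.a₄ - W.a₁ * y := by
  rw [Affine.slope_of_Y_ne rfl h, div_mul_cancel₀ _ (sub_ne_zero.mpr h)]

theorem addX_self_mul_eval_Ψ₂Sq (h : W.toAffine.Equation x y) (hy : y ≠ W.toAffine.negY x y) :
    W.toAffine.addX x x (W.toAffine.slope x x y y) * W.Ψ₂Sq.eval x = (W.Φ 2).eval x := by
  rw [eval_Φ_two, eval_Ψ₃_eq h, eval_Ψ₂Sq_eq_sq h, ← slope_self_mul hy, Affine.addX]
  ring

theorem exists_two_nsmul_eq_some (h : W.toAffine.Nonsingular x y) (hx : W.Ψ₂Sq.eval x ≠ 0) :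
    ∃ (x₂ y₂ : F) (h₂ : W.toAffine.Nonsingular x₂ y₂),
      2 • Affine.Point.some x y h = Affine.Point.some x₂ y₂ h₂ ∧
        x₂ * W.Ψ₂Sq.eval x = (W.Φ 2).eval x := by
  have hy : y ≠ W.toAffine.negY x y := mt (eval_Ψ₂Sq_eq_zero_iff h.1).mpr hx
  exact ⟨_, _, _, (two_nsmul _).trans (Affine.Point.add_self_of_Y_ne hy),
    addX_self_mul_eval_Ψ₂Sq h.1 hy⟩

theorem three_nsmul_some_eq_zero_iff (h : W.toAffine.Nonsingular x y) :
    3 • Affine.Point.some x y h = 0 ↔ W.Ψ₃.eval x = 0 := by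
  by_cases hx : W.Ψ₂Sq.eval x = 0
  · rw [succ_nsmul, (two_nsmul_some_eq_zero_iff h).mpr hx, zero_add]
    exact iff_of_false (Affine.Point.some_ne_zero h) (eval_Ψ₃_ne_zero_of_eval_Ψ₂Sq_eq_zero h hx)
  obtain ⟨x₂, y₂, h₂, hdbl, hx₂⟩ := exists_two_nsmul_eq_some h hx
  have hne : Affine.Point.some x₂ y₂ h₂ ≠ Affine.Point.some x y h := by
    rw [← hdbl, two_nsmul, Ne, add_eq_left]
    exact Affine.Point.some_ne_zero h
  calc 3 • Affine.Point.some x y h = 0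
      ↔ x₂ = x := by
        rw [succ_nsmul, hdbl, add_eq_zero_iff_eq_neg, Affine.Point.X_eq_iff (h₁ := h₂) (h₂ := h),
          or_iff_right hne]
    _ ↔ W.Ψ₃.eval x = 0 := by
        rw [← mul_left_inj' hx, hx₂, eval_Φ_two, sub_eq_self]

theorem addX_addX_self_mul_eval_Ψ₃_sq {x₂ y₂ : F} (h : W.toAffine.Equation x y)
    (hy : y ≠ W.toAffine.negY x y) (hne : x₂ ≠ x)
    (hx₂ : x₂ = W.toAffine.addX x x (W.toAffine.slope x x y y))
    (hy₂ : y₂ = W.toAffine.addY x x y (W.toAffine.slope x x y y)) :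
    W.toAffine.addX x₂ x (W.toAffine.slope x₂ x y₂ y) * W.Ψ₃.eval x ^ 2 = (W.Φ 3).eval x := by
  have hdbl : (x₂ - x) * (y - W.toAffine.negY x y) ^ 2 = -W.Ψ₃.eval x := by
    rw [← eval_Ψ₂Sq_eq_sq h, hx₂, sub_mul, addX_self_mul_eval_Ψ₂Sq h hy, eval_Φ_two]
    ring
  have hl : (2 * W.toAffine.slope x x y y + W.a₁) * (y - W.toAffine.negY x y) =
      6 * x ^ 2 + W.b₂ * x + W.b₄ := by
    rw [add_mul, mul_assoc, slope_self_mul hy, Affine.negY, b₂, b₄]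
    ring
  rw [Φ_three, eval_sub, eval_mul, eval_mul, eval_pow, eval_X, eval_preΨ₄, eval_Ψ₂Sq_eq_sq h, ← hl,
    ← neg_eq_iff_eq_neg.mpr hdbl, Affine.slope_of_X_ne hne]
  have hslope : (y₂ - y) / (x₂ - x) = -(W.toAffine.slope x x y y + W.a₁) -
      (y - W.toAffine.negY x y) / (x₂ - x) := by
    rw [eq_sub_iff_add_eq, ← add_div, div_eq_iff (sub_ne_zero.mpr hne), hy₂, Affine.addY,
      Affine.negAddY, ← hx₂, Affine.negY, Affine.negY]
    ring
  rw [hslope, Affine.addX]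
  rw [Affine.addX] at hx₂
  generalize W.toAffine.slope x x y y = l at *
  generalize y - W.toAffine.negY x y = w at *
  have hx : x₂ - x ≠ 0 := sub_ne_zero.mpr hne
  field_simp
  linear_combination -(x₂ - x) ^ 2 * w ^ 4 * hx₂

theorem exists_three_nsmul_eq_some (h : W.toAffine.Nonsingular x y) (hx : W.Ψ₃.eval x ≠ 0) :
    ∃ (x₃ y₃ : F) (h₃ : W.toAffine.Nonsingular x₃ y₃),
      3 • Affine.Point.some x y h = Affine.Point.some x₃ y₃ h₃ ∧
        x₃ * W.Ψ₃.eval x ^ 2 = (W.Φ 3).eval x := by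
  by_cases hx₂ : W.Ψ₂Sq.eval x = 0
  · refine ⟨x, y, h, ?_, by simp [Φ_three, hx₂]⟩
    rw [succ_nsmul, (two_nsmul_some_eq_zero_iff h).mpr hx₂, zero_add]
  have hy : y ≠ W.toAffine.negY x y := mt (eval_Ψ₂Sq_eq_zero_iff h.1).mpr hx₂
  have hne : W.toAffine.addX x x (W.toAffine.slope x x y y) ≠ x := by
    rwa [Ne, ← mul_left_inj' hx₂, addX_self_mul_eval_Ψ₂Sq h.1 hy, eval_Φ_two, sub_eq_self]
  exact ⟨_, _, _, by rw [succ_nsmul, two_nsmul, Affine.Point.add_self_of_Y_ne hy,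
    Affine.Point.add_of_X_ne hne], addX_addX_self_mul_eval_Ψ₃_sq h.1 hy hne rfl rfl⟩

end DivisionPolynomials

section Padic

variable {p : ℕ} [Fact p.Prime]

theorem norm_aeval_of_one_lt {f : ℤ_[p][X]} {x : ℚ_[p]} (hx : 1 < ‖f.leadingCoeff‖ * ‖x‖) :
    ‖aeval x f‖ = ‖f.leadingCoeff‖ * ‖x‖ ^ f.natDegree := by
  have hx1 : 1 < ‖x‖ := hx.trans_le
    (mul_le_of_le_one_left (norm_nonneg x) (PadicInt.norm_le_one _))
  set top : ℚ_[p] := f.coeff f.natDegree • x ^ f.natDegree with htop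
  have hnorm : ‖top‖ = ‖f.leadingCoeff‖ * ‖x‖ ^ f.natDegree := by
    rw [htop, Algebra.smul_def, norm_mul, norm_pow]
    rfl
  have hlower : ‖∑ i ∈ Finset.range f.natDegree, f.coeff i • x ^ i‖ < ‖top‖ := by
    rw [hnorm]
    rcases f.natDegree with _ | n
    · simpa using pos_of_mul_pos_left (one_pos.trans hx) (norm_nonneg x)
    have hterm : ∀ i ∈ Finset.range (n + 1), ‖f.coeff i • x ^ i‖ ≤ ‖x‖ ^ n := fun i hi ↦ by
      rw [Algebra.smul_def, norm_mul, norm_pow]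
      exact (mul_le_of_le_one_left (by positivity) (PadicInt.norm_le_one _)).trans
        (pow_le_pow_right₀ hx1.le (Finset.mem_range_succ_iff.mp hi))
    calc _ ≤ ‖x‖ ^ n := IsUltrametricDist.norm_sum_le_of_forall_le_of_nonneg (by positivity) hterm
      _ < ‖f.leadingCoeff‖ * ‖x‖ * ‖x‖ ^ n := lt_mul_of_one_lt_left (by positivity) hx
      _ = ‖f.leadingCoeff‖ * ‖x‖ ^ (n + 1) := by ring
  rw [aeval_eq_sum_range, Finset.sum_range_succ,
    IsUltrametricDist.norm_add_eq_max_of_norm_ne_norm hlower.ne, max_eq_right hlower.le, hnorm]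

theorem natCast_le_norm_of_one_lt_norm {a : ℚ_[p]} (ha : 1 < ‖a‖) : (p : ℝ) ≤ ‖a‖ := by
  have h := mt (Padic.norm_le_pow_iff_norm_lt_pow_add_one a 0).mpr (by simpa using ha)
  simpa using h

end Padic

section KernelOfReduction

variable {W : WeierstrassCurve ℤ_[3]} {x y : ℚ_[3]}

theorem nine_le_norm_of_one_lt_norm (h : (W.baseChange ℚ_[3]).toAffine.Equation x y)
    (hx : 1 < ‖x‖) : 9 ≤ ‖x‖ := by
  have h4 : ‖(4 : ℤ_[3])‖ = 1 := by
    exact_mod_cast PadicInt.norm_natCast_eq_one_iff.mpr (by norm_num : Nat.Coprime 3 4)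
  have h40 : (4 : ℤ_[3]) ≠ 0 := norm_ne_zero_iff.mp (by rw [h4]; exact one_ne_zero)
  set w := y - (W.baseChange ℚ_[3]).toAffine.negY x y
  have hw : ‖w‖ ^ 2 = ‖x‖ ^ 3 := by
    rw [← norm_pow, ← eval_Ψ₂Sq_eq_sq h, baseChange, map_Ψ₂Sq, eval_map_algebraMap,
      norm_aeval_of_one_lt] <;>
    simp [W.leadingCoeff_Ψ₂Sq h40, W.natDegree_Ψ₂Sq h40, h4, hx]
  have hwx : ‖w / x‖ ^ 2 = ‖x‖ := by
    rw [norm_div, div_pow, hw]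
    field_simp
  have h3 : 3 ≤ ‖w / x‖ := by
    refine natCast_le_norm_of_one_lt_norm ((one_lt_sq_iff₀ (norm_nonneg _)).mp ?_)
    rwa [hwx]
  nlinarith

variable [DecidableEq ℚ_[3]]

theorem exists_three_nsmul_eq_some_of_one_lt_norm
    (h : (W.baseChange ℚ_[3]).toAffine.Nonsingular x y) (hx : 1 < ‖x‖) :
    ∃ (x₃ y₃ : ℚ_[3]) (h₃ : (W.baseChange ℚ_[3]).toAffine.Nonsingular x₃ y₃),
      3 • Affine.Point.some x y h = Affine.Point.some x₃ y₃ h₃ ∧ ‖x₃‖ = 9 * ‖x‖ := by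
  have hx9 := nine_le_norm_of_one_lt_norm h.1 hx
  have h3 : ‖(3 : ℤ_[3])‖ = 3⁻¹ := by exact_mod_cast PadicInt.norm_p (p := 3)
  have h30 : (3 : ℤ_[3]) ≠ 0 := norm_ne_zero_iff.mp (by rw [h3]; positivity)
  have hΨ : ‖(W.baseChange ℚ_[3]).Ψ₃.eval x‖ = 3⁻¹ * ‖x‖ ^ 4 := by
    rw [baseChange, map_Ψ₃, eval_map_algebraMap, norm_aeval_of_one_lt] <;>
    rw [W.leadingCoeff_Ψ₃ h30, h3]
    · rw [W.natDegree_Ψ₃ h30]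
    · linarith
  have hΦ : ‖((W.baseChange ℚ_[3]).Φ 3).eval x‖ = ‖x‖ ^ 9 := by
    rw [baseChange, map_Φ, eval_map_algebraMap, norm_aeval_of_one_lt] <;>
    simp only [W.leadingCoeff_Φ, W.natDegree_Φ, norm_one, one_mul, Int.reduceAbs, Nat.reducePow, hx]
  obtain ⟨x₃, y₃, h₃, htriple, hx₃⟩ := exists_three_nsmul_eq_some h
    (norm_ne_zero_iff.mp (by rw [hΨ]; positivity))
  refine ⟨x₃, y₃, h₃, htriple, mul_right_cancel₀ (b := (3⁻¹ * ‖x‖ ^ 4) ^ 2) (by positivity) ?_⟩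
  rw [← hΨ, ← norm_pow, ← norm_mul, hx₃, hΦ, norm_pow, hΨ]
  ring

theorem exists_pow_three_nsmul_eq_some_of_one_lt_norm
    (h : (W.baseChange ℚ_[3]).toAffine.Nonsingular x y) (hx : 1 < ‖x‖) (k : ℕ) :
    ∃ (x' y' : ℚ_[3]) (h' : (W.baseChange ℚ_[3]).toAffine.Nonsingular x' y'),
      3 ^ k • Affine.Point.some x y h = Affine.Point.some x' y' h' ∧ ‖x'‖ = 9 ^ k * ‖x‖ := by
  induction k with
  | zero => exact ⟨x, y, h, by simp, by simp⟩
  | succ k ih =>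
    obtain ⟨x', y', h', hk, hx'⟩ := ih
    have hx'1 : 1 < ‖x'‖ := hx' ▸ one_lt_mul_of_le_of_lt (one_le_pow₀ (by norm_num)) hx
    obtain ⟨x₃, y₃, h₃, h3, hx₃⟩ := exists_three_nsmul_eq_some_of_one_lt_norm h' hx'1
    exact ⟨x₃, y₃, h₃, by rw [pow_succ', mul_nsmul', hk, h3], by rw [hx₃, hx', pow_succ']; ring⟩

theorem norm_le_one_of_isOfFinAddOrder {h : (W.baseChange ℚ_[3]).toAffine.Nonsingular x y}
    (hP : IsOfFinAddOrder (Affine.Point.some x y h)) : ‖x‖ ≤ 1 := by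
  by_contra! hx
  refine Set.infinite_of_injective_forall_mem (f := fun k : ℕ ↦ 3 ^ k • Affine.Point.some x y h)
    (fun i j hij ↦ ?_) (fun k ↦ nsmul_mem (AddSubmonoid.mem_multiples _) (3 ^ k))
    hP.finite_multiples
  obtain ⟨xi, yi, hi, ei, hxi⟩ := exists_pow_three_nsmul_eq_some_of_one_lt_norm h hx i
  obtain ⟨xj, yj, hj, ej, hxj⟩ := exists_pow_three_nsmul_eq_some_of_one_lt_norm h hx j
  have hxij : xi = xj := ((Affine.Point.some.injEq ..).mp (ei.symm.trans (hij.trans ej))).1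
  rw [hxij, hxj] at hxi
  exact pow_right_injective₀ (by norm_num : (0 : ℝ) < 9) (by norm_num)
    (mul_right_cancel₀ (by positivity) hxi).symm

end KernelOfReduction

section ReductionModThree

-- The points of order `3` over `ZMod 3` are those with `x = -b₆`, and every other point that is not
-- killed by `2` doubles to one of them.
theorem eval_neg_b₆_of_zmod_three {W : WeierstrassCurve (ZMod 3)} (h₂ : W.b₂ = 1) (h₄ : W.b₄ = 0)
    (h₆ : W.b₆ ≠ 0) : W.Ψ₃.eval (-W.b₆) = 0 ∧ (W.Φ 3).eval (-W.b₆) ≠ 0 := by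
  have h₈ := W.b_relation
  simp only [Ψ₃, Ψ₂Sq, Φ_three, preΨ₄, h₂, h₄, eval_add, eval_sub, eval_mul, eval_pow, eval_X,
    eval_C, eval_ofNat] at h₈ ⊢
  generalize W.b₆ = b₆, W.b₈ = b₈ at h₆ h₈ ⊢
  revert b₆ b₈
  decide

theorem eq_neg_b₆_or_eq_neg_b₆_of_zmod_three {W : WeierstrassCurve (ZMod 3)} (h₂ : W.b₂ = 1)
    (h₄ : W.b₄ = 0) (h₆ : W.b₆ ≠ 0) {x x₂ : ZMod 3} (hx : IsSquare (W.Ψ₂Sq.eval x))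
    (hx₂ : x₂ * W.Ψ₂Sq.eval x = (W.Φ 2).eval x) : x = -W.b₆ ∨ x₂ = -W.b₆ := by
  have h₈ := W.b_relation
  obtain ⟨w, hw⟩ := hx
  simp only [Φ_two, Ψ₂Sq, h₂, h₄, eval_add, eval_sub, eval_mul, eval_pow, eval_X,
    eval_C] at h₈ hw hx₂ ⊢
  generalize W.b₆ = b₆, W.b₈ = b₈ at *
  revert b₆ b₈ x x₂ w
  decide

theorem toZMod_mul_eval_map_toZMod {p : ℕ} [Fact p.Prime] {f g : ℤ_[p][X]} {α ξ : ℤ_[p]}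
    (h : (α : ℚ_[p]) * (f.map (algebraMap ℤ_[p] ℚ_[p])).eval (ξ : ℚ_[p]) =
      (g.map (algebraMap ℤ_[p] ℚ_[p])).eval (ξ : ℚ_[p])) :
    PadicInt.toZMod α * (f.map PadicInt.toZMod).eval (PadicInt.toZMod ξ) =
      (g.map PadicInt.toZMod).eval (PadicInt.toZMod ξ) := by
  rw [eval_map_apply, eval_map_apply, ← map_mul]
  congr 1
  apply IsFractionRing.injective ℤ_[p] ℚ_[p]
  rw [map_mul, ← eval_map_apply, ← eval_map_apply]
  exact h

theorem isSquare_eval_map_toZMod_Ψ₂Sq {p : ℕ} [Fact p.Prime] {W : WeierstrassCurve ℤ_[p]}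
    {ξ : ℤ_[p]} {y : ℚ_[p]} (h : (W.baseChange ℚ_[p]).toAffine.Equation ξ y) :
    IsSquare ((W.map PadicInt.toZMod).Ψ₂Sq.eval (PadicInt.toZMod ξ)) := by
  have hw : algebraMap ℤ_[p] ℚ_[p] (W.Ψ₂Sq.eval ξ) =
      (y - (W.baseChange ℚ_[p]).toAffine.negY ξ y) ^ 2 := by
    rw [← eval_map_apply, ← map_Ψ₂Sq]
    exact eval_Ψ₂Sq_eq_sq h
  obtain ⟨ω, hω⟩ := IsIntegrallyClosed.exists_algebraMap_eq_of_isIntegral_pow (R := ℤ_[p])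
    two_pos (hw ▸ isIntegral_algebraMap)
  rw [map_Ψ₂Sq, eval_map_apply]
  refine IsSquare.map PadicInt.toZMod ⟨ω, IsFractionRing.injective ℤ_[p] ℚ_[p] ?_⟩
  rw [hw, ← hω, map_mul, sq]

variable {W : WeierstrassCurve ℤ_[3]} [DecidableEq ℚ_[3]]

theorem exists_two_nsmul_eq_some_padicInt {ξ : ℤ_[3]} {y : ℚ_[3]}
    {h : (W.baseChange ℚ_[3]).toAffine.Nonsingular ξ y}
    (hP : IsOfFinAddOrder (Affine.Point.some (ξ : ℚ_[3]) y h))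
    (h2 : 2 • Affine.Point.some (ξ : ℚ_[3]) y h ≠ 0) :
    ∃ (ξ₂ : ℤ_[3]) (y₂ : ℚ_[3]) (h₂ : (W.baseChange ℚ_[3]).toAffine.Nonsingular ξ₂ y₂),
      2 • Affine.Point.some (ξ : ℚ_[3]) y h = Affine.Point.some (ξ₂ : ℚ_[3]) y₂ h₂ ∧
      PadicInt.toZMod ξ₂ * (W.map PadicInt.toZMod).Ψ₂Sq.eval (PadicInt.toZMod ξ) =
        ((W.map PadicInt.toZMod).Φ 2).eval (PadicInt.toZMod ξ) := by
  obtain ⟨x₂, y₂, h₂, hdbl, hx₂⟩ :=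
    exists_two_nsmul_eq_some h (mt (two_nsmul_some_eq_zero_iff h).mpr h2)
  have hx₂' := norm_le_one_of_isOfFinAddOrder (hdbl ▸ hP.nsmul)
  rw [baseChange, map_Ψ₂Sq, map_Φ] at hx₂
  refine ⟨⟨x₂, hx₂'⟩, y₂, h₂, hdbl, ?_⟩
  rw [map_Ψ₂Sq, map_Φ]
  exact toZMod_mul_eval_map_toZMod hx₂

theorem exists_toZMod_mul_eval_Ψ₃_sq {ξ : ℤ_[3]} {y : ℚ_[3]}
    {h : (W.baseChange ℚ_[3]).toAffine.Nonsingular ξ y}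
    (hP : IsOfFinAddOrder (Affine.Point.some (ξ : ℚ_[3]) y h))
    (h3 : 3 • Affine.Point.some (ξ : ℚ_[3]) y h ≠ 0) :
    ∃ a : ZMod 3, a * (W.map PadicInt.toZMod).Ψ₃.eval (PadicInt.toZMod ξ) ^ 2 =
        ((W.map PadicInt.toZMod).Φ 3).eval (PadicInt.toZMod ξ) := by
  obtain ⟨x₃, y₃, h₃, htriple, hx₃⟩ :=
    exists_three_nsmul_eq_some h (mt (three_nsmul_some_eq_zero_iff h).mpr h3)
  have hx₃' := norm_le_one_of_isOfFinAddOrder (htriple ▸ hP.nsmul)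
  rw [baseChange, map_Ψ₃, map_Φ, ← eval_pow, ← Polynomial.map_pow] at hx₃
  rw [map_Ψ₃, map_Φ, ← eval_pow, ← Polynomial.map_pow]
  exact ⟨_, toZMod_mul_eval_map_toZMod (α := ⟨x₃, hx₃'⟩) hx₃⟩

theorem toZMod_ne_neg_b₆_of_isOfFinAddOrder (hb₂ : (W.map PadicInt.toZMod).b₂ = 1)
    (hb₄ : (W.map PadicInt.toZMod).b₄ = 0) (hb₆ : (W.map PadicInt.toZMod).b₆ ≠ 0)
    {ξ : ℤ_[3]} {y : ℚ_[3]} {h : (W.baseChange ℚ_[3]).toAffine.Nonsingular ξ y}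
    (hP : IsOfFinAddOrder (Affine.Point.some (ξ : ℚ_[3]) y h))
    (h3 : 3 • Affine.Point.some (ξ : ℚ_[3]) y h ≠ 0) :
    PadicInt.toZMod ξ ≠ -(W.map PadicInt.toZMod).b₆ := by
  intro hξ
  obtain ⟨hΨ, hΦ⟩ := eval_neg_b₆_of_zmod_three hb₂ hb₄ hb₆
  obtain ⟨a, ha⟩ := exists_toZMod_mul_eval_Ψ₃_sq hP h3
  rw [hξ, hΨ] at ha
  exact hΦ (by rw [← ha]; ring)

theorem six_nsmul_eq_zero_of_isOfFinAddOrder (hb₂ : (W.map PadicInt.toZMod).b₂ = 1)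
    (hb₄ : (W.map PadicInt.toZMod).b₄ = 0) (hb₆ : (W.map PadicInt.toZMod).b₆ ≠ 0)
    {P : (W.baseChange ℚ_[3]).toAffine.Point} (hP : IsOfFinAddOrder P) : 6 • P = 0 := by
  by_contra h6
  rcases P with _ | ⟨x, y, h⟩
  · exact h6 (nsmul_zero 6)
  obtain ⟨ξ, rfl⟩ : ∃ ξ : ℤ_[3], (ξ : ℚ_[3]) = x := ⟨⟨x, norm_le_one_of_isOfFinAddOrder hP⟩, rfl⟩
  have h2 : 2 • Affine.Point.some _ y h ≠ 0 := fun h2 ↦ h6 (by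
    rw [show 6 = 2 * 3 by rfl, mul_nsmul, h2, nsmul_zero])
  have h3 : 3 • Affine.Point.some _ y h ≠ 0 := fun h3 ↦ h6 (by
    rw [show 6 = 3 * 2 by rfl, mul_nsmul, h3, nsmul_zero])
  obtain ⟨ξ₂, y₂, h₂, hdbl, hξ₂⟩ := exists_two_nsmul_eq_some_padicInt hP h2
  have hres := toZMod_ne_neg_b₆_of_isOfFinAddOrder hb₂ hb₄ hb₆ hP h3
  have hres₂ := toZMod_ne_neg_b₆_of_isOfFinAddOrder hb₂ hb₄ hb₆ (hdbl ▸ hP.nsmul)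
    (by rwa [← hdbl, ← mul_nsmul])
  exact (eq_neg_b₆_or_eq_neg_b₆_of_zmod_three hb₂ hb₄ hb₆ (isSquare_eval_map_toZMod_Ψ₂Sq h.1)
    hξ₂).elim hres hres₂

end ReductionModThree

section RationalPoints

variable {W : WeierstrassCurve ℚ} {𝓦 : WeierstrassCurve ℤ_[3]}

theorem six_nsmul_eq_zero_of_baseChange_eq (hW : W.baseChange ℚ_[3] = 𝓦.baseChange ℚ_[3])
    (hb₂ : (𝓦.map PadicInt.toZMod).b₂ = 1) (hb₄ : (𝓦.map PadicInt.toZMod).b₄ = 0)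
    (hb₆ : (𝓦.map PadicInt.toZMod).b₆ ≠ 0) {P : W.toAffine.Point} (hP : IsOfFinAddOrder P) :
    6 • P = 0 := by
  classical
  have hpadic : ∀ Q : (W.baseChange ℚ_[3]).toAffine.Point, IsOfFinAddOrder Q → 6 • Q = 0 := by
    rw [hW]
    exact fun Q ↦ six_nsmul_eq_zero_of_isOfFinAddOrder hb₂ hb₄ hb₆
  let ι : W.toAffine.Point →+ (W.baseChange ℚ_[3]).toAffine.Point :=
    Affine.Point.baseChange (W' := W) ℚ ℚ_[3]
  have hι : Function.Injective ι := Affine.Point.map_injective (W' := W) (Algebra.ofId ℚ ℚ_[3])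
  exact (map_eq_zero_iff ι hι).mp ((map_nsmul ι 6 P).trans (hpadic _ (ι.isOfFinAddOrder hP)))

theorem torsion_eq_bot_of_baseChange_eq (hW : W.baseChange ℚ_[3] = 𝓦.baseChange ℚ_[3])
    (hb₂ : (𝓦.map PadicInt.toZMod).b₂ = 1) (hb₄ : (𝓦.map PadicInt.toZMod).b₄ = 0)
    (hb₆ : (𝓦.map PadicInt.toZMod).b₆ ≠ 0)
    (hΨ₂ : ∀ x y, W.toAffine.Equation x y → W.Ψ₂Sq.eval x ≠ 0)
    (hΨ₃ : ∀ x y, W.toAffine.Equation x y → W.Ψ₃.eval x ≠ 0) :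
    AddCommGroup.torsion W.toAffine.Point = ⊥ := by
  have h2 : ∀ P : W.toAffine.Point, 2 • P = 0 → P = 0
    | .zero, _ => rfl
    | .some x y h, h0 => absurd ((two_nsmul_some_eq_zero_iff h).mp h0) (hΨ₂ x y h.1)
  have h3 : ∀ P : W.toAffine.Point, 3 • P = 0 → P = 0
    | .zero, _ => rfl
    | .some x y h, h0 => absurd ((three_nsmul_some_eq_zero_iff h).mp h0) (hΨ₃ x y h.1)
  refine (AddSubgroup.eq_bot_iff_forall _).mpr fun P hP ↦ h2 P (h3 _ ?_)
  rw [← mul_nsmul]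
  exact six_nsmul_eq_zero_of_baseChange_eq hW hb₂ hb₄ hb₆ hP

end RationalPoints

section DivisionPolynomialsOfTwist

theorem exists_intCast_eq_of_cubic {q : ℚ} (a b c : ℤ) (h : q ^ 3 + a * q ^ 2 + b * q + c = 0) :
    ∃ k : ℤ, k = q := by
  refine IsIntegrallyClosed.isIntegral_iff.mp
    (⟨X ^ 3 + C a * X ^ 2 + C b * X + C c, by monicity!, ?_⟩ : IsIntegral ℤ q)
  simp only [eval₂_add, eval₂_mul, eval₂_pow, eval₂_X, eval₂_C]
  exact h

theorem not_isSquare_neg_three_mul {d : ℤ} (hd : ¬ (3 : ℤ) ∣ d) : ¬ IsSquare (-3 * d : ℚ) := by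
  have hcast : (-3 * d : ℚ) = ((-3 * d : ℤ) : ℚ) := by push_cast; rfl
  rw [hcast, Rat.isSquare_intCast_iff]
  rintro ⟨k, hk⟩
  have h3k : (3 : ℤ) ∣ k := by
    refine (or_self_iff).mp (Int.prime_three.dvd_or_dvd ⟨-d, ?_⟩)
    linear_combination -hk
  obtain ⟨l, rfl⟩ := h3k
  exact hd ⟨-l ^ 2, by linarith⟩

variable {s : ℤ}

theorem mul_three_mul_sub_sq_ne (hs : s = 1 ∨ s = -1) {a : ℤ} (ha : 1 < |a|) (k : ℤ) :
    k * (3 * a - k) ^ 2 ≠ 4 * s := by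
  intro h
  have hprod : |k| * |3 * a - k| ^ 2 = 4 := by
    rw [← abs_pow, ← abs_mul, h]
    rcases hs with rfl | rfl <;> rfl
  have hsum : 6 ≤ |k| + |3 * a - k| := calc
    6 ≤ 3 * |a| := by linarith
    _ = |k + (3 * a - k)| := by rw [add_sub_cancel, abs_mul, Nat.abs_ofNat]
    _ ≤ |k| + |3 * a - k| := abs_add_le _ _
  have hk : |k| ≤ 4 := Int.le_of_dvd (by norm_num) ⟨_, hprod.symm⟩
  have hk0 := abs_nonneg k
  generalize |k| = u, |3 * a - k| = v at *
  interval_cases u <;> nlinarith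

theorem cube_ne_three_mul_sq (hs : s = 1 ∨ s = -1) {a : ℤ} (ha : 1 < |a|) (z : ℚ) :
    z ^ 3 ≠ 3 * (a * z + B s) ^ 2 := by
  intro h
  have hs2 : (s : ℚ) ^ 2 = 1 := by rcases hs with rfl | rfl <;> norm_num
  rw [B] at h
  have hz : z ≠ 0 := by
    rintro rfl
    nlinarith
  have hcubic : (4 * s / (3 * z) : ℚ) ^ 3 + (-(6 * a) : ℤ) * (4 * s / (3 * z)) ^ 2 +
      (9 * a ^ 2 : ℤ) * (4 * s / (3 * z)) + (-(4 * s) : ℤ) = 0 := by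
    push_cast
    field_simp
    linear_combination -108 * s * h
  obtain ⟨k, hk⟩ := exists_intCast_eq_of_cubic _ _ _ hcubic
  rw [← hk] at hcubic
  refine mul_three_mul_sub_sq_ne hs ha k ?_
  have : (k * (3 * a - k) ^ 2 : ℚ) = 4 * s := by push_cast at hcubic; linear_combination hcubic
  exact_mod_cast this

theorem cube_ne_four_mul (hs : s = 1 ∨ s = -1) {a : ℤ} (ha : 1 < |a|) {z : ℚ} (hz : z ≠ 0) :
    z ^ 3 ≠ 4 * (a ^ 2 * z ^ 2 + 3 * a * B s * z + 3 * B s ^ 2) := by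
  intro h
  have hs2 : (s : ℚ) ^ 2 = 1 := by rcases hs with rfl | rfl <;> norm_num
  have hs0 : (s : ℚ) ≠ 0 := by rcases hs with rfl | rfl <;> norm_num
  have ha0 : (a : ℚ) ≠ 0 := Int.cast_ne_zero.mpr (by rintro rfl; simp at ha)
  have hfermat : (a + 3 * B s / z) ^ 3 + (s : ℚ) ^ 3 = (a : ℚ) ^ 3 := by
    rw [B] at h ⊢
    field_simp
    linear_combination 729 * s * h + 729 * z ^ 3 * s * hs2
  have hc : a + 3 * B s / z = 0 := by
    by_contra hc
    exact fermatLastTheoremFor_iff_rat.mp fermatLastTheoremThree _ _ _ hc hs0 ha0 hfermat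
  rw [hc, zero_pow three_ne_zero, zero_add] at hfermat
  have hsa : s = a := (Odd.strictMono_pow (by decide : Odd 3)).injective (by exact_mod_cast hfermat)
  rcases hs with rfl | rfl <;> simp [← hsa] at ha

theorem eval_Ψ₂Sq_twist (m n : ℤ) {d : ℚ} (hd : d ≠ 0) (x : ℚ) :
    16 * (quadraticTwist (E s m n) d).Ψ₂Sq.eval x =
      d ^ 3 * ((4 * x / d + r s m n) ^ 3 -
        3 * (A s m n * (4 * x / d + r s m n) + B s) ^ 2) := by
  simp only [Ψ₂Sq, b₂, b₄, b₆, quadraticTwist, E, H, J, r, D, eval_add, eval_mul, eval_pow, eval_X,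
    eval_C]
  generalize A s m n = a, B s = b
  field_simp
  ring

theorem eval_Ψ₃_twist (m n : ℤ) {d : ℚ} (hd : d ≠ 0) (x : ℚ) :
    256 * (quadraticTwist (E s m n) d).Ψ₃.eval x =
      3 * d ^ 4 * ((4 * x / d + r s m n) * ((4 * x / d + r s m n) ^ 3 -
        4 * (A s m n ^ 2 * (4 * x / d + r s m n) ^ 2 +
          3 * A s m n * B s * (4 * x / d + r s m n) + 3 * B s ^ 2))) := by
  simp only [Ψ₃, b₂, b₄, b₆, b₈, quadraticTwist, E, H, J, r, D, eval_add, eval_mul, eval_pow,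
    eval_X, eval_C, eval_ofNat]
  generalize A s m n = a, B s = b
  field_simp
  ring

theorem exists_A_eq_intCast (hs : s = 1 ∨ s = -1) {m : ℤ} (hm : ¬ (3 : ℤ) ∣ m) (n : ℤ) :
    ∃ a : ℤ, 1 < |a| ∧ A s m n = a :=
  ⟨18 * (m + 24 * n) + s, lt_abs.mpr (by omega), by rw [A]; push_cast; rfl⟩

theorem eval_Ψ₂Sq_twist_ne_zero (hs : s = 1 ∨ s = -1) {m : ℤ} (hm : ¬ (3 : ℤ) ∣ m)
    (n : ℤ) {d : ℚ} (hd : d ≠ 0) (x : ℚ) :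
    (quadraticTwist (E s m n) d).Ψ₂Sq.eval x ≠ 0 := by
  obtain ⟨a, ha, hA⟩ := exists_A_eq_intCast hs hm n
  refine right_ne_zero_of_mul (a := 16) ?_
  rw [eval_Ψ₂Sq_twist m n hd, hA]
  exact mul_ne_zero (pow_ne_zero 3 hd) (sub_ne_zero.mpr (cube_ne_three_mul_sq hs ha _))

theorem eval_Ψ₃_twist_ne_zero (hs : s = 1 ∨ s = -1) {m d : ℤ} (hm : ¬ (3 : ℤ) ∣ m)
    (n : ℤ) (hd : ¬ (3 : ℤ) ∣ d) {x y : ℚ}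
    (h : (quadraticTwist (E s m n) d).toAffine.Equation x y) :
    (quadraticTwist (E s m n) d).Ψ₃.eval x ≠ 0 := by
  obtain ⟨a, ha, hA⟩ := exists_A_eq_intCast hs hm n
  have hs2 : (s : ℚ) ^ 2 = 1 := by rcases hs with rfl | rfl <;> norm_num
  have hd0 : (d : ℚ) ≠ 0 := Int.cast_ne_zero.mpr (by rintro rfl; exact hd (dvd_zero 3))
  have hz : 4 * x / d + r s m n ≠ 0 := by
    intro hz
    have hw := eval_Ψ₂Sq_twist (s := s) m n hd0 x
    rw [hz, eval_Ψ₂Sq_eq_sq h, B] at hw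
    refine not_isSquare_neg_three_mul hd
      ⟨9 * (y - (quadraticTwist (E s m n) d).toAffine.negY x y) / d, ?_⟩
    field_simp
    linear_combination (-81 / 16) * hw + 3 * d ^ 3 * hs2
  refine right_ne_zero_of_mul (a := 256) ?_
  rw [eval_Ψ₃_twist m n hd0, hA]
  exact mul_ne_zero (mul_ne_zero three_ne_zero (pow_ne_zero 4 hd0))
    (mul_ne_zero hz (sub_ne_zero.mpr (cube_ne_four_mul hs ha hz)))

end DivisionPolynomialsOfTwist

section IntegralModel

theorem exists_integral_model_quadraticTwist {W : WeierstrassCurve ℚ} (h₁ : W.a₁ = 1)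
    (h₂ : W.a₂ = 0) (h₃ : W.a₃ = 0) {N M : ℤ} (h₄ : 16 * W.a₄ = N) (h₆ : 64 * W.a₆ = M) (d : ℤ) :
    ∃ 𝓦 : WeierstrassCurve ℤ_[3],
      (quadraticTwist W d).baseChange ℚ_[3] = 𝓦.baseChange ℚ_[3] ∧
      (𝓦.map PadicInt.toZMod).b₂ = d ∧ (𝓦.map PadicInt.toZMod).b₄ = 2 * d ^ 2 * N ∧
      (𝓦.map PadicInt.toZMod).b₆ = d ^ 3 * M := by
  have h2 : ‖(2 : ℤ_[3])‖ = 1 := by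
    exact_mod_cast PadicInt.norm_natCast_eq_one_iff.mpr (by norm_num : Nat.Coprime 3 2)
  obtain ⟨κ, hκ⟩ := (PadicInt.isUnit_iff.mpr h2).exists_right_inv
  have hκℚ : algebraMap ℤ_[3] ℚ_[3] κ = 2⁻¹ := by
    have h := congrArg (algebraMap ℤ_[3] ℚ_[3]) hκ
    rw [map_mul, map_ofNat, map_one] at h
    exact eq_inv_of_mul_eq_one_right h
  have hκ3 : PadicInt.toZMod κ = 2 := by
    have h := congrArg (PadicInt.toZMod (p := 3)) hκ
    rw [map_mul, map_ofNat, map_one] at h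
    generalize PadicInt.toZMod κ = k at h ⊢
    revert k
    decide
  refine ⟨⟨1, (d - 1) * κ ^ 2, 0, d ^ 2 * (N * κ ^ 4), d ^ 3 * (M * κ ^ 6)⟩, ?_, ?_, ?_, ?_⟩
  · rw [mul_comm, ← eq_div_iff (by norm_num)] at h₄ h₆
    ext <;>
      simp only [baseChange, quadraticTwist, map_a₁, map_a₂, map_a₃, map_a₄, map_a₆, h₁, h₂, h₃, h₄,
        h₆, hκℚ, map_add, map_mul, map_sub, map_pow, map_div₀, map_intCast, map_ofNat, map_one,
        map_zero] <;>
      ring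
  all_goals
    simp only [b₂, b₄, b₆, map_a₁, map_a₂, map_a₃, map_a₄, map_a₆, map_mul, map_sub, map_pow,
      map_intCast, map_one, map_zero, hκ3]
    generalize (d : ZMod 3) = d', (N : ZMod 3) = N', (M : ZMod 3) = M'
    revert d' N' M'
    decide

theorem sixteen_mul_H {s : ℤ} (hs : s = 1 ∨ s = -1) (m n : ℤ) :
    16 * H s m n =
      (48 * s * (m + 24 * n) + 3 - 3 * (18 * (m + 24 * n) + s) ^ 4 : ℤ) := by
  rcases hs with rfl | rfl <;>
  · simp only [H, r, A, B, D]
    push_cast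
    ring

theorem sixtyFour_mul_J {s : ℤ} (hs : s = 1 ∨ s = -1) (m n : ℤ) :
    64 * J s m n =
      (15552 * s * (m + 24 * n) ^ 3 + 2592 * (m + 24 * n) ^ 2 + 160 * s * (m + 24 * n) + 3 -
        (18 * (m + 24 * n) + s) ^ 4 - 2 * (18 * (m + 24 * n) + s) ^ 6 : ℤ) := by
  rcases hs with rfl | rfl <;>
  · simp only [J, r, A, B, D]
    push_cast
    ring

theorem exists_integral_model_twist_E {s m d : ℤ} (hs : s = 1 ∨ s = -1) (hm : ¬ (3 : ℤ) ∣ m)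
    (n : ℤ) (hd : d ≡ 1 [ZMOD 3]) :
    ∃ 𝓦 : WeierstrassCurve ℤ_[3],
      (quadraticTwist (E s m n) d).baseChange ℚ_[3] = 𝓦.baseChange ℚ_[3] ∧
      (𝓦.map PadicInt.toZMod).b₂ = 1 ∧ (𝓦.map PadicInt.toZMod).b₄ = 0 ∧
      (𝓦.map PadicInt.toZMod).b₆ ≠ 0 := by
  obtain ⟨𝓦, h𝓦, hb₂, hb₄, hb₆⟩ := exists_integral_model_quadraticTwist (W := E s m n) rfl rfl rfl
    (sixteen_mul_H hs m n) (sixtyFour_mul_J hs m n) d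
  have hd' : (d : ZMod 3) = 1 := by
    exact_mod_cast (ZMod.intCast_eq_intCast_iff d 1 3).mpr hd
  have hm' : (m : ZMod 3) ≠ 0 := (ZMod.intCast_zmod_eq_zero_iff_dvd m 3).not.mpr hm
  rw [hd'] at hb₂ hb₄ hb₆
  refine ⟨𝓦, h𝓦, hb₂, ?_, ?_⟩
  · rw [hb₄]
    push_cast
    reduce_mod_char
  · rw [hb₆]
    push_cast
    generalize (m : ZMod 3) = m' at hm'
    generalize (n : ZMod 3) = n'
    rcases hs with rfl | rfl <;> push_cast <;> revert m' n' <;> decide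

end IntegralModel

end TwistTorsion

theorem proposition3p6_general (s m n d : ℤ) (hs : s = 1 ∨ s = -1) (hm : ¬ (3 : ℤ) ∣ m)
    (hd : d ≡ 1 [ZMOD 3]) :
    AddCommGroup.torsion
      (TwistTorsion.quadraticTwist (TwistTorsion.E s m n) (d : ℚ)).toAffine.Point = ⊥ := by
  obtain ⟨𝓦, h𝓦, hb₂, hb₄, hb₆⟩ := TwistTorsion.exists_integral_model_twist_E hs hm n hd
  have h3d : ¬ (3 : ℤ) ∣ d := by rw [Int.ModEq] at hd; omega
  have hd0 : (d : ℚ) ≠ 0 := Int.cast_ne_zero.mpr (by rintro rfl; exact h3d (dvd_zero 3))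
  exact TwistTorsion.torsion_eq_bot_of_baseChange_eq h𝓦 hb₂ hb₄ hb₆
    (fun x _ _ ↦ TwistTorsion.eval_Ψ₂Sq_twist_ne_zero hs hm n hd0 x)
    (fun _ _ h ↦ TwistTorsion.eval_Ψ₃_twist_ne_zero hs hm n h3d h)

theorem proposition3p6 (s m n d : ℤ) (hs : s = 1 ∨ s = -1)
    (hm : m ∈ ({1, 2, 5, 7, 8, 10, 11, 13, 14, 16, 17, 19, 22, 23} : Set ℤ))
    (hn0 : 0 ≤ n) (hn : TwistTorsion.Admissible s m n)
    (hd0 : 0 < d) (hd : Squarefree d) (hd12 : d ≡ 1 [ZMOD 12]) :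
    AddCommGroup.torsion
      (TwistTorsion.quadraticTwist (TwistTorsion.E s m n) (d : ℚ)).toAffine.Point = ⊥ := by
  simp only [Set.mem_insert_iff, Set.mem_singleton_iff] at hm
  exact proposition3p6_general s m n d hs (by omega) (hd12.of_dvd (by norm_num))
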